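/- Work over $\mathbb{C}$, with finite-dimensional vector spaces. For a projective variety $X\subset\mathbb{P}V$ let $\widehat X\subset V$ be its affine cone, $T_\alpha\widehat X\subset V$ its tangent space at a smooth point $\alpha$, and let $$\mathfrak{aut}(\widehat X)=\{g\in \mathrm{End}(V): g(\alpha)\in T_\alpha\widehat X \text{ for every smooth point } \alpha\in\widehat X\}.$$ Its first prolongation $\mathfrak{aut}(\widehat X)^{(1)}$ is the space of symmetric bilinear maps $A:V\times V\to V$ such that $A(w,\cdot)\in\mathfrak{aut}(\widehat X)$ for every $w\in V$. An irreducible nondegenerate projective subvariety $X\subset \mathbb{P}V$ is called quadratically symmetric if there is a nonempty Zariski open subset $X^o$ of its nonsingular locus such that for each $P\in X^o$ there is a linear $\mathbb{C}^*$-action on $V$ and a decomposition $V=\widehat P\oplus T'\oplus N'$, where $\widehat P$ is the line over $P$ and $\widehat P\oplus T'=T_P(\widehat X)$ is the affine tangent space, such that $\lambda\in\mathbb{C}^*$ acts by $(t,u,w)\mapsto(t,\lambda u,\lambda^2 w)$ and the induced action on $\mathbb{P}V$ preserves $X$. For a symmetric bilinear map $\sigma:U\times U\to W$ whose induced linear map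 $\mathrm{Sym}^2U\to W$ is surjective, let $Z(\sigma)\subset\mathbb{P}(\mathbb{C}\oplus U\oplus W)$ be the closure of the image of the rational map $[t:u]\mapsto[t^2:tu:\sigma(u,u)]$ on $\mathbb{P}(\mathbb{C}\oplus U)$, and let $$A_\sigma\big((t_1,u_1,w_1),(t_2,u_2,w_2)\big)=\Big(t_1t_2,\ \tfrac{t_1u_2+t_2u_1}{2},\ \sigma(u_1,u_2)\Big).$$ **Proposition.** (a) If $X\subset\mathbb{P}V$ is quadratically symmetric, then $\mathfrak{aut}(\widehat X)^{(1)}\neq 0$. More precisely, there are $U$, $W$, $\sigma$ as above and a linear isomorphism $e:V\to\mathbb{C}\oplus U\oplus W$ that carries $X$ onto $Z(\sigma)$, and the bilinear map $A$ on $V$ with $e(A(v,w))=A_\sigma(e(v),e(w))$ lies in $\mathfrak{aut}(\widehat X)^{(1)}$. (b) For all $U$, $W$, $\sigma$ as above, $A_\sigma\in\mathfrak{aut}(\widehat{Z(\sigma)})^{(1)}$. -/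

import Mathlib

open Module

namespace QuadSymm

/-- Polynomial functions on a complex vector space `V`: the algebra of functions generated by the
linear functionals. For `V` of finite dimension this is the polynomial ring `ℂ[V]`. -/
def polyFun (V : Type*) [AddCommGroup V] [Module ℂ V] : Subalgebra ℂ (V → ℂ) :=
  Algebra.adjoin ℂ (Set.range fun φ : Dual ℂ V => (φ : V → ℂ))

section Basics

variable {V : Type*} [AddCommGroup V] [Module ℂ V]

/-- `f` is homogeneous of degree `d`. -/
def IsHomog (f : V → ℂ) (d : ℕ) : Prop :=
  ∀ (c : ℂ) (v : V), f (c • v) = c ^ d * f v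

/-- A polynomial function has a differential at every point `α`: one linear functional computes
all its directional derivatives at `α`. -/
theorem exists_differential {f : V → ℂ} (hf : f ∈ polyFun V) (α : V) :
    ∃ D : Dual ℂ V, ∀ v : V, HasDerivAt (fun ε : ℂ => f (α + ε • v)) (D v) 0 := by
  refine Algebra.adjoin_induction (p := fun f _ => ∃ D : Dual ℂ V, ∀ v : V,
    HasDerivAt (fun ε : ℂ => f (α + ε • v)) (D v) 0) ?_ ?_ ?_ ?_ hf
  · rintro _ ⟨φ, rfl⟩
    refine ⟨φ, fun v => ?_⟩
    have h : HasDerivAt (fun ε : ℂ => φ α + ε * φ v) (φ v) 0 := by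
      simpa using ((hasDerivAt_id (0 : ℂ)).mul_const (φ v)).const_add (φ α)
    simpa using h
  · intro c
    exact ⟨0, fun v => by simpa [Algebra.algebraMap_eq_smul_one] using hasDerivAt_const (0 : ℂ) c⟩
  · rintro f g _ _ ⟨D, hD⟩ ⟨D', hD'⟩
    exact ⟨D + D', fun v => (hD v).add (hD' v)⟩
  · rintro f g _ _ ⟨D, hD⟩ ⟨D', hD'⟩
    refine ⟨g α • D + f α • D', fun v => ?_⟩
    have h := (hD v).mul (hD' v)
    have e : (g α • D + f α • D') v
        = D v * g (α + (0 : ℂ) • v) + f (α + (0 : ℂ) • v) * D' v := by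
      simp [mul_comm]
    rw [e]
    exact h

/-- The common zero locus in `ℙ V` of a set of functions on `V` (used for homogeneous ones). -/
def zeroLocus (S : Set (V → ℂ)) : Set (Projectivization ℂ V) :=
  {P | ∀ f ∈ S, f P.rep = 0}

/-- Closed algebraic subsets of `ℙ V`: common zero loci of homogeneous polynomials. -/
def IsAlgebraic (X : Set (Projectivization ℂ V)) : Prop :=
  ∃ S : Set (V → ℂ), (∀ f ∈ S, f ∈ polyFun V ∧ ∃ d : ℕ, IsHomog f d) ∧ X = zeroLocus S

theorem isAlgebraic_empty : IsAlgebraic (∅ : Set (Projectivization ℂ V)) := by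
  refine ⟨{1}, ?_, ?_⟩
  · rintro f rfl
    exact ⟨one_mem _, 0, fun c v => by simp⟩
  · ext P
    simp [zeroLocus]

theorem isAlgebraic_sInter (A : Set (Set (Projectivization ℂ V)))
    (hA : ∀ X ∈ A, IsAlgebraic X) : IsAlgebraic (⋂₀ A) := by
  choose! S hS hX using hA
  refine ⟨⋃ X ∈ A, S X, ?_, ?_⟩
  · intro f hf
    simp only [Set.mem_iUnion] at hf
    obtain ⟨X, hXA, hfX⟩ := hf
    exact hS X hXA f hfX
  · ext P
    simp only [Set.mem_sInter, zeroLocus, Set.mem_iUnion, Set.mem_ofPred_eq]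
    constructor
    · rintro h f ⟨X, hXA, hfX⟩
      have := h X hXA
      rw [hX X hXA] at this
      exact this f hfX
    · intro h X hXA
      rw [hX X hXA]
      exact fun f hf => h f ⟨X, hXA, hf⟩

theorem isAlgebraic_union (X Y : Set (Projectivization ℂ V))
    (hX : IsAlgebraic X) (hY : IsAlgebraic Y) : IsAlgebraic (X ∪ Y) := by
  obtain ⟨S, hS, rfl⟩ := hX
  obtain ⟨S', hS', rfl⟩ := hY
  refine ⟨{h | ∃ f ∈ S, ∃ g ∈ S', h = f * g}, ?_, ?_⟩
  · rintro _ ⟨f, hf, g, hg, rfl⟩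
    obtain ⟨hfp, d, hd⟩ := hS f hf
    obtain ⟨hgp, e, he⟩ := hS' g hg
    refine ⟨mul_mem hfp hgp, d + e, fun c v => ?_⟩
    simp only [Pi.mul_apply, hd c v, he c v]
    ring
  · ext P
    constructor
    · rintro (h | h)
      · rintro _ ⟨f, hf, g, hg, rfl⟩
        simp [h f hf]
      · rintro _ ⟨f, hf, g, hg, rfl⟩
        simp [h g hg]
    · intro h
      by_contra hne
      simp only [Set.mem_union, zeroLocus, Set.mem_ofPred_eq, not_or, not_forall] at hne
      obtain ⟨⟨f, hf, hf0⟩, ⟨g, hg, hg0⟩⟩ := hne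
      have := h (f * g) ⟨f, hf, g, hg, rfl⟩
      simp [hf0, hg0] at this

/-- The Zariski topology on `ℙ V`. -/
abbrev zariski (V : Type*) [AddCommGroup V] [Module ℂ V] :
    TopologicalSpace (Projectivization ℂ V) :=
  TopologicalSpace.ofClosed {X | IsAlgebraic X} isAlgebraic_empty
    (fun A hA => isAlgebraic_sInter A hA)
    (fun X hX Y hY => isAlgebraic_union X Y hX hY)

/-- The affine cone `X̂ ⊆ V` over `X ⊆ ℙ V` (the vertex `0` included). -/
def affineCone (X : Set (Projectivization ℂ V)) : Set V :=
  {v | ∀ h : v ≠ 0, Projectivization.mk ℂ v h ∈ X}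

/-- The ideal of the polynomial functions that vanish on a set `S ⊆ V`. -/
def vanishingIdeal (S : Set V) : Ideal (polyFun V) where
  carrier := {f | ∀ x ∈ S, (f : V → ℂ) x = 0}
  zero_mem' := fun x _ => rfl
  add_mem' := fun {f g} hf hg x hx => by simp [hf x hx, hg x hx]
  smul_mem' := fun c f hf x hx => by simp [hf x hx]

/-- The affine tangent space `T_α(X̂) ⊆ V`: the vectors killed by the differentials at `α` of all
polynomials vanishing on the affine cone. -/
def tangentSpace (X : Set (Projectivization ℂ V)) (α : V) : Submodule ℂ V where
  carrier := {v | ∀ f ∈ vanishingIdeal (affineCone X),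
    deriv (fun ε : ℂ => (f : V → ℂ) (α + ε • v)) 0 = 0}
  zero_mem' := fun f _ => by simp
  add_mem' := fun {v w} hv hw f hf => by
    obtain ⟨D, hD⟩ := exists_differential f.2 α
    have h1 := hv f hf
    have h2 := hw f hf
    rw [(hD _).deriv] at h1 h2 ⊢
    rw [map_add, h1, h2, add_zero]
  smul_mem' := fun c v hv f hf => by
    obtain ⟨D, hD⟩ := exists_differential f.2 α
    have h1 := hv f hf
    rw [(hD _).deriv] at h1 ⊢
    rw [map_smul, h1, smul_zero]

/-- `α` is a smooth point of the affine cone over the irreducible variety `X`: the dimension of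
the tangent space is the Krull dimension of the coordinate ring of the cone. -/
def IsSmoothPoint (X : Set (Projectivization ℂ V)) (α : V) : Prop :=
  α ∈ affineCone X ∧
    (finrank ℂ (tangentSpace X α) : WithBot ℕ∞) =
      ringKrullDim (polyFun V ⧸ vanishingIdeal (affineCone X))

/-- The nonsingular locus of the irreducible variety `X`. A point of `X` is nonsingular exactly
when the points of the affine cone over it, other than the vertex, are. -/
def smoothLocus (X : Set (Projectivization ℂ V)) : Set (Projectivization ℂ V) :=
  {P | P ∈ X ∧ IsSmoothPoint X P.rep}

/-- The linear `ℂ*`-action `E` on `V` has weight `0` on the line `P̂`, weight `1` on `T_P(X̂) / P̂`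
and weight `2` on `V / T_P(X̂)`, and the induced action on `ℙ V` preserves `X`. -/
def IsQuadraticSymmetryAt (X : Set (Projectivization ℂ V)) (P : Projectivization ℂ V)
    (E : ℂˣ →* (V ≃ₗ[ℂ] V)) : Prop :=
  (∃ T' N' : Submodule ℂ V,
    Disjoint P.submodule T' ∧ P.submodule ⊔ T' = tangentSpace X P.rep ∧
    IsCompl (P.submodule ⊔ T') N' ∧
    ∀ (l : ℂˣ), ∀ t ∈ P.submodule, ∀ u ∈ T', ∀ w ∈ N',
      E l (t + u + w) = t + (l : ℂ) • u + ((l : ℂ) ^ 2) • w) ∧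
  ∀ l : ℂˣ,
    Projectivization.map (E l : V →ₗ[ℂ] V) (E l).injective '' X = X

/-- Quadratically symmetric varieties: irreducible nondegenerate projective subvarieties `X` of
`ℙ V` with a quadratic `ℂ*`-symmetry at each point of a nonempty Zariski open subset of the
nonsingular locus. -/
structure IsQuadraticallySymmetric (X : Set (Projectivization ℂ V)) : Prop where
  isClosed : @IsClosed _ (zariski V) X
  irreducible : @IsIrreducible _ (zariski V) X
  nondegenerate : Submodule.span ℂ (affineCone X) = ⊤
  exists_symmetry : ∃ O : Set (Projectivization ℂ V), @IsOpen _ (zariski V) O ∧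
    (X ∩ O).Nonempty ∧ X ∩ O ⊆ smoothLocus X ∧
    ∀ P ∈ X ∩ O, ∃ E : ℂˣ →* (V ≃ₗ[ℂ] V), IsQuadraticSymmetryAt X P E

/-- `aut(X̂)`: the endomorphisms `g` of `V` with `g(α) ∈ T_α(X̂)` for all smooth points `α` of the
affine cone. -/
def autCone (X : Set (Projectivization ℂ V)) : Submodule ℂ (End ℂ V) where
  carrier := {g | ∀ α : V, IsSmoothPoint X α → g α ∈ tangentSpace X α}
  zero_mem' := fun α _ => by simp
  add_mem' := fun hg hh α hα => add_mem (hg α hα) (hh α hα)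
  smul_mem' := fun c _ hg α hα => Submodule.smul_mem _ c (hg α hα)

/-- The first prolongation of `𝔤 ⊆ End V`: the symmetric bilinear maps `A : V × V → V` such that
`A(w, ·) ∈ 𝔤` for all `w`. (The definition only uses the linear structure of `𝔤`.) -/
def prolongation (𝔤 : Submodule ℂ (End ℂ V)) : Submodule ℂ (V →ₗ[ℂ] V →ₗ[ℂ] V) where
  carrier := {A | (∀ v w, A v w = A w v) ∧ ∀ w, A w ∈ 𝔤}
  zero_mem' := ⟨fun _ _ => rfl, fun _ => zero_mem 𝔤⟩
  add_mem' := fun {A B} hA hB =>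
    ⟨fun v w => by simp [hA.1 v w, hB.1 v w], fun w => add_mem (hA.2 w) (hB.2 w)⟩
  smul_mem' := fun c A hA =>
    ⟨fun v w => by simp [hA.1 v w], fun w => Submodule.smul_mem _ c (hA.2 w)⟩

end Basics

section Quadrics

variable {U W : Type*} [AddCommGroup U] [Module ℂ U] [AddCommGroup W] [Module ℂ W]

/-- The symmetric bilinear map `σ` corresponds to a surjective linear map `Sym² U → W`. -/
structure IsSurjSym (σ : U →ₗ[ℂ] U →ₗ[ℂ] W) : Prop where
  symm : ∀ u v, σ u v = σ v u
  surj : Submodule.span ℂ {w | ∃ u v, w = σ u v} = ⊤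

/-- `Z(σ) ⊆ ℙ(ℂ ⊕ U ⊕ W)`: the Zariski closure of the image of the rational map
`[t : u] ↦ [t² : tu : σ(u,u)]`. -/
def quadricImage (σ : U →ₗ[ℂ] U →ₗ[ℂ] W) : Set (Projectivization ℂ (ℂ × U × W)) :=
  @closure _ (zariski (ℂ × U × W))
    {Q | ∃ (t : ℂ) (u : U) (h : (t ^ 2, t • u, σ u u) ≠ (0 : ℂ × U × W)),
      Q = Projectivization.mk ℂ (t ^ 2, t • u, σ u u) h}

/-- The bilinear map
`A((t₁,u₁,w₁), (t₂,u₂,w₂)) = (t₁t₂, (t₁u₂ + t₂u₁)/2, σ(u₁,u₂))` on `ℂ ⊕ U ⊕ W`. -/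
noncomputable def quadricBilin (σ : U →ₗ[ℂ] U →ₗ[ℂ] W) :
    (ℂ × U × W) →ₗ[ℂ] (ℂ × U × W) →ₗ[ℂ] (ℂ × U × W) :=
  LinearMap.mk₂ ℂ
    (fun x y => (x.1 * y.1, (2⁻¹ : ℂ) • (x.1 • y.2.1 + y.1 • x.2.1), σ x.2.1 y.2.1))
    (fun x x' y => by
      ext
      · simp [add_mul]
      · simp only [Prod.fst_add, Prod.snd_add]
        module
      · simp)
    (fun c x y => by
      ext
      · simp [mul_assoc]
      · simp only [Prod.smul_fst, Prod.smul_snd, smul_eq_mul]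
        module
      · simp)
    (fun x y y' => by
      ext
      · simp [mul_add]
      · simp only [Prod.fst_add, Prod.snd_add]
        module
      · simp)
    (fun c x y => by
      ext
      · simp [mul_left_comm]
      · simp only [Prod.smul_fst, Prod.smul_snd, smul_eq_mul]
        module
      · simp)

end Quadrics

end QuadSymm

/-!
Let `X` be quadratically symmetric, let `E` be the `ℂ*`-action at one point `P = [p]` of `X`, with
`V = P̂ ⊕ T' ⊕ N'`; a single point suffices. For an equation `f` of the cone with Taylor expansion
`D + Q + ⋯` at `p` and a point `p + u + w` of the cone, `f` vanishes on the whole orbit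
`p + l u + l² w`, and the coefficient of `l²` reads `D w + Q u u = 0`
(`IsTwoJet.add_eq_zero_of_symmetry`). The differentials `D` form the annihilator of the tangent
space `P̂ ⊕ T'` (`conormalSpace_eq_dualAnnihilator`), so every coordinate of `N'` occurs as a `D`,
and the chart of `X` around `P` lies in the graph `w = σ(u,u)` of a quadratic map (`exists_graph`).

It remains to see that the chart is the whole graph. Smoothness at `P` says that the coordinate ring
of the cone has dimension `1 + dim T'`. It is a domain (`vanishingIdeal_isPrime`) and, because of
the relation `t w = σ(u,u)`, it is algebraic over the coordinates `t`, `u`; by Noether normalization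
these are then algebraically independent (`algebraicIndependent_of_card_le_ringKrullDim`). Hence the
cones over `X` and over `Z(σ)` have the same equations, namely the polynomials that vanish
identically after the substitution `(t², tu, σ(u,u))` (`map_image_eq_quadricImage`), and `X` is
carried onto `Z(σ)`.

For `Z(σ)` itself, `A_σ(x, ·)` is a linear vector field which at `(t², tu, σ(u,u))` is the velocity
of a curve in the image of the parametrization. Its derivative of an equation is a polynomial that
vanishes on this image, hence on the closure (`quadricBilin_mem_tangentSpace`).
-/

namespace QuadSymm

/-! ### Polynomial functions -/

section PolyFun

variable {V Y : Type*} [AddCommGroup V] [Module ℂ V] [AddCommGroup Y] [Module ℂ Y]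

theorem dual_mem_polyFun (φ : Dual ℂ V) : (φ : V → ℂ) ∈ polyFun V :=
  Algebra.subset_adjoin ⟨φ, rfl⟩

@[elab_as_elim]
theorem polyFun_induction {p : (f : V → ℂ) → f ∈ polyFun V → Prop}
    (dual : ∀ φ : Dual ℂ V, p φ (dual_mem_polyFun φ))
    (const : ∀ c : ℂ, p (fun _ => c) ((polyFun V).algebraMap_mem c))
    (add : ∀ f g hf hg, p f hf → p g hg → p (f + g) (add_mem hf hg))
    (mul : ∀ f g hf hg, p f hf → p g hg → p (f * g) (mul_mem hf hg))
    {f : V → ℂ} (hf : f ∈ polyFun V) : p f hf := by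
  refine Algebra.adjoin_induction (p := p) ?_ ?_ ?_ ?_ hf
  · rintro _ ⟨φ, rfl⟩
    exact dual φ
  · exact const
  · exact fun f g hf hg => add f g hf hg
  · exact fun f g hf hg => mul f g hf hg

theorem comp_mem_polyFun {v : Y → V} (hv : ∀ φ : Dual ℂ V, (fun y => φ (v y)) ∈ polyFun Y)
    {f : V → ℂ} (hf : f ∈ polyFun V) : (fun y => f (v y)) ∈ polyFun Y := by
  induction hf using polyFun_induction with
  | dual φ => exact hv φ
  | const c => exact (polyFun Y).algebraMap_mem c
  | add f g _ _ hf hg => exact add_mem hf hg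
  | mul f g _ _ hf hg => exact mul_mem hf hg

theorem comp_linear_mem_polyFun (L : Y →ₗ[ℂ] V) {f : V → ℂ} (hf : f ∈ polyFun V) :
    (fun y => f (L y)) ∈ polyFun Y :=
  comp_mem_polyFun (fun φ => dual_mem_polyFun (φ ∘ₗ L)) hf

/-- `D` and `Q` are the linear part and the quadratic part of the Taylor expansion of `f` at `p`.
They are recorded along the curves `p + l u + l² w`, because these are the orbits of a quadratic
`ℂ*`-symmetry: the coefficient of `l²` of `f` on such a curve is `D w + Q u u`. -/
structure IsTwoJet (f : V → ℂ) (p : V) (D : Dual ℂ V) (Q : V →ₗ[ℂ] V →ₗ[ℂ] ℂ) : Prop where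
  symm : ∀ u w, Q u w = Q w u
  exists_polynomial : ∀ u w : V, ∃ r : Polynomial ℂ,
    (∀ l : ℂ, f (p + l • u + l ^ 2 • w) = r.eval l) ∧
      r.coeff 0 = f p ∧ r.coeff 1 = D u ∧ r.coeff 2 = D w + Q u u

namespace IsTwoJet

variable {f g : V → ℂ} {p : V} {D D' : Dual ℂ V} {Q Q' : V →ₗ[ℂ] V →ₗ[ℂ] ℂ}

theorem dual (φ : Dual ℂ V) (p : V) : IsTwoJet φ p φ 0 := by
  refine ⟨fun _ _ => rfl, fun u w => ⟨.C (φ p) + .C (φ u) * .X + .C (φ w) * .X ^ 2, ?_, ?_⟩⟩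
  · intro l
    simp
    ring
  · simp [Polynomial.coeff_X, Polynomial.coeff_C]

theorem const (c : ℂ) (p : V) : IsTwoJet (fun _ => c) p 0 0 :=
  ⟨fun _ _ => rfl, fun u w => ⟨.C c, by simp, by simp [Polynomial.coeff_C]⟩⟩

theorem add (h : IsTwoJet f p D Q) (h' : IsTwoJet g p D' Q') :
    IsTwoJet (f + g) p (D + D') (Q + Q') := by
  refine ⟨fun u w => by simp [h.symm u w, h'.symm u w], fun u w => ?_⟩
  obtain ⟨r, hr, h0, h1, h2⟩ := h.exists_polynomial u w
  obtain ⟨r', hr', h0', h1', h2'⟩ := h'.exists_polynomial u w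
  refine ⟨r + r', fun l => by simp [hr, hr'], by simp [h0, h0'], by simp [h1, h1'], ?_⟩
  simp [h2, h2']
  ring

theorem mul (h : IsTwoJet f p D Q) (h' : IsTwoJet g p D' Q') :
    IsTwoJet (f * g) p (f p • D' + g p • D)
      (f p • Q' + g p • Q + (2⁻¹ : ℂ) • (D.smulRight D' + D'.smulRight D)) := by
  refine ⟨fun u w => ?_, fun u w => ?_⟩
  · simp [h.symm u w, h'.symm u w]
    ring
  obtain ⟨r, hr, h0, h1, h2⟩ := h.exists_polynomial u w
  obtain ⟨r', hr', h0', h1', h2'⟩ := h'.exists_polynomial u w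
  refine ⟨r * r', fun l => by simp [hr, hr'], by simp [Polynomial.mul_coeff_zero, h0, h0'], ?_, ?_⟩
  · simp [Polynomial.mul_coeff_one, h0, h0', h1, h1']
    ring
  · simp [Polynomial.coeff_mul, Finset.Nat.antidiagonal_succ, h0, h0', h1, h1', h2, h2']
    ring

theorem hasDerivAt (h : IsTwoJet f p D Q) (v : V) :
    HasDerivAt (fun ε : ℂ => f (p + ε • v)) (D v) 0 := by
  obtain ⟨r, hr, -, h1, -⟩ := h.exists_polynomial v 0
  have e : (fun ε : ℂ => f (p + ε • v)) = fun ε => r.eval ε := by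
    funext ε
    simpa using hr ε
  rw [e, ← h1]
  convert! r.hasDerivAt 0 using 1
  simp [← Polynomial.coeff_zero_eq_eval_zero, Polynomial.coeff_derivative]

theorem eq_zero_of_forall_ne_zero (h : IsTwoJet f p D Q) {u w : V}
    (h0 : ∀ l : ℂ, l ≠ 0 → f (p + l • u + l ^ 2 • w) = 0) : D u = 0 ∧ D w + Q u u = 0 := by
  obtain ⟨r, hr, -, h1, h2⟩ := h.exists_polynomial u w
  have : r = 0 := by
    refine Polynomial.eq_zero_of_infinite_isRoot r ?_
    refine (Set.finite_singleton (0 : ℂ)).infinite_compl.mono fun l hl => ?_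
    rw [Set.mem_ofPred_eq, Polynomial.IsRoot, ← hr]
    exact h0 l hl
  rw [← h1, ← h2, this]
  simp

end IsTwoJet

theorem exists_isTwoJet {f : V → ℂ} (hf : f ∈ polyFun V) (p : V) :
    ∃ D Q, IsTwoJet f p D Q := by
  induction hf using polyFun_induction with
  | dual φ => exact ⟨_, _, .dual φ p⟩
  | const c => exact ⟨_, _, .const c p⟩
  | add f g _ _ hf hg =>
    obtain ⟨⟨_, _, h⟩, ⟨_, _, h'⟩⟩ := hf, hg
    exact ⟨_, _, h.add h'⟩
  | mul f g _ _ hf hg =>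
    obtain ⟨⟨_, _, h⟩, ⟨_, _, h'⟩⟩ := hf, hg
    exact ⟨_, _, h.mul h'⟩

/-- The derivative of a polynomial function along a linear vector field is a polynomial
function. -/
theorem exists_lieDerivative (L : End ℂ V) {f : V → ℂ} (hf : f ∈ polyFun V) :
    ∃ g ∈ polyFun V, ∀ α, HasDerivAt (fun ε : ℂ => f (α + ε • L α)) (g α) 0 := by
  induction hf using polyFun_induction with
  | dual φ =>
    exact ⟨_, dual_mem_polyFun (φ ∘ₗ L), fun α => (IsTwoJet.dual φ α).hasDerivAt (L α)⟩
  | const c => exact ⟨0, zero_mem _, fun α => hasDerivAt_const _ _⟩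
  | add f g _ _ hf hg =>
    obtain ⟨⟨f', hf', h⟩, ⟨g', hg', h'⟩⟩ := hf, hg
    exact ⟨f' + g', add_mem hf' hg', fun α => (h α).add (h' α)⟩
  | mul f g hf hg ihf ihg =>
    obtain ⟨⟨f', hf', h⟩, ⟨g', hg', h'⟩⟩ := ihf, ihg
    refine ⟨f' * g + f * g', add_mem (mul_mem hf' hg) (mul_mem hf hg'), fun α => ?_⟩
    have h0 := (h α).mul (h' α)
    simp only [zero_smul, add_zero] at h0
    exact h0

/-- Decomposition into homogeneous components, encoded as a polynomial over the ring of functions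
whose coefficient in degree `d` is the component of degree `d`. -/
theorem exists_homogeneousComponents {f : V → ℂ} (hf : f ∈ polyFun V) :
    ∃ r : Polynomial (V → ℂ), (∀ d, r.coeff d ∈ polyFun V ∧ IsHomog (r.coeff d) d) ∧
      r.eval 1 = f := by
  have zero : ∀ d : ℕ, IsHomog (0 : V → ℂ) d := fun d c v => by simp
  induction hf using polyFun_induction with
  | dual φ =>
    refine ⟨.C (φ : V → ℂ) * .X, fun d => ?_, by simp⟩
    rw [Polynomial.coeff_C_mul, Polynomial.coeff_X]
    split_ifs with h
    · subst h
      exact ⟨by simpa using dual_mem_polyFun φ, fun c v => by simp⟩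
    · exact ⟨by simp, by simpa using zero d⟩
  | const c =>
    refine ⟨.C fun _ => c, fun d => ?_, by simp⟩
    rw [Polynomial.coeff_C]
    split_ifs with h
    · subst h
      exact ⟨(polyFun V).algebraMap_mem c, fun c v => by simp⟩
    · exact ⟨by simp, zero d⟩
  | add f g _ _ hf hg =>
    obtain ⟨⟨r, hr, rfl⟩, ⟨s, hs, rfl⟩⟩ := hf, hg
    refine ⟨r + s, fun d => ?_, by simp⟩
    rw [Polynomial.coeff_add]
    refine ⟨add_mem (hr d).1 (hs d).1, fun c v => ?_⟩
    simp [(hr d).2 c v, (hs d).2 c v, mul_add]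
  | mul f g _ _ hf hg =>
    obtain ⟨⟨r, hr, rfl⟩, ⟨s, hs, rfl⟩⟩ := hf, hg
    refine ⟨r * s, fun d => ?_, by simp⟩
    rw [Polynomial.coeff_mul]
    refine ⟨sum_mem fun x _ => mul_mem (hr _).1 (hs _).1, fun c v => ?_⟩
    simp only [Finset.sum_apply, Pi.mul_apply, Finset.mul_sum]
    refine Finset.sum_congr rfl fun x hx => ?_
    rw [(hr _).2 c v, (hs _).2 c v, ← Finset.HasAntidiagonal.mem_antidiagonal.1 hx]
    ring

theorem eval_mvPolynomial_eq {ι : Type*} (x : ι → polyFun V) (F : MvPolynomial ι ℂ) (α : V) :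
    (MvPolynomial.aeval x F : V → ℂ) α = MvPolynomial.eval (fun i => (x i : V → ℂ) α) F := by
  have h := MvPolynomial.map_aeval x
    ((Pi.evalRingHom (fun _ : V => ℂ) α).comp (polyFun V).val.toRingHom) F
  refine h.trans ?_
  rw [MvPolynomial.coe_eval₂Hom, ← MvPolynomial.eval₂_id]
  rfl

/-- A polynomial function is a polynomial in the coordinates of any basis. -/
theorem exists_mvPolynomial {ι : Type*} [Fintype ι] (B : Basis ι ℂ Y) {f : Y → ℂ}
    (hf : f ∈ polyFun Y) :
    ∃ F : MvPolynomial ι ℂ, ∀ y, f y = MvPolynomial.eval (fun i => B.coord i y) F := by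
  induction hf using polyFun_induction with
  | dual φ =>
    refine ⟨∑ i, .C (φ (B i)) * .X i, fun y => ?_⟩
    conv_lhs => rw [← B.sum_repr y, map_sum]
    simp [mul_comm]
  | const c => exact ⟨.C c, by simp⟩
  | add f g _ _ hf hg =>
    obtain ⟨⟨F, hF⟩, ⟨G, hG⟩⟩ := hf, hg
    exact ⟨F + G, by simp [hF, hG]⟩
  | mul f g _ _ hf hg =>
    obtain ⟨⟨F, hF⟩, ⟨G, hG⟩⟩ := hf, hg
    exact ⟨F * G, by simp [hF, hG]⟩

instance [FiniteDimensional ℂ V] : Algebra.FiniteType ℂ (polyFun V) := by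
  let B := finBasis ℂ V
  refine .of_surjective (MvPolynomial.aeval fun i => (⟨B.coord i, dual_mem_polyFun _⟩ : polyFun V))
    fun f => ?_
  obtain ⟨F, hF⟩ := exists_mvPolynomial B f.2
  refine ⟨F, Subtype.ext (funext fun α => ?_)⟩
  rw [eval_mvPolynomial_eq, hF]

end PolyFun

/-! ### Krull dimension and algebraic independence -/

section Dimension

theorem ringKrullDim_le_of_isIntegral {R S : Type*} [CommRing R] [CommRing S] (f : R →+* S)
    (hf : f.IsIntegral) : ringKrullDim S ≤ ringKrullDim R := by
  algebraize [f]
  exact Order.krullDim_le_of_strictMono (PrimeSpectrum.comap f)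
    fun _ _ h => Ideal.IsIntegral.comap_lt_comap (R := R) h

/-- The Krull dimension of a finitely generated algebra over a field is at most its transcendence
degree, so a family over which a domain is algebraic and which is not larger than the Krull
dimension satisfies no algebraic relation. -/
theorem algebraicIndependent_of_card_le_ringKrullDim {k A ι : Type*} [Field k] [CommRing A]
    [IsDomain A] [Algebra k A] [Algebra.FiniteType k A] [Finite ι] (x : ι → A)
    [Algebra.IsAlgebraic (Algebra.adjoin k (Set.range x)) A]
    (h : (Nat.card ι : WithBot ℕ∞) ≤ ringKrullDim A) : AlgebraicIndependent k x := by
  obtain ⟨s, g, hinj, hint⟩ := exists_integral_inj_algHom_of_fg k A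
  have h1 : (Nat.card ι : WithBot ℕ∞) ≤ (s : ℕ) := by
    refine h.trans ((ringKrullDim_le_of_isIntegral g.toRingHom hint).trans ?_)
    simp
  have h2 : Nat.card ι ≤ s := by exact_mod_cast h1
  have h3 : (s : Cardinal) ≤ Algebra.trdeg k A := by
    have := ((MvPolynomial.algebraicIndependent_X (Fin s) k).map' hinj).lift_cardinalMk_le_trdeg
    simpa using this
  refine (Algebra.IsAlgebraic.isTranscendenceBasis_of_lift_le_trdeg_of_finite k x ?_).1
  rw [← Nat.cast_card, Cardinal.lift_natCast]
  refine le_trans (Nat.cast_le.2 h2) ?_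
  have := Cardinal.lift_le.2 h3
  rwa [Cardinal.lift_natCast] at this

end Dimension

/-! ### Cones, their ideals and their tangent spaces -/

section Cones

variable {V V' : Type*} [AddCommGroup V] [Module ℂ V] [AddCommGroup V'] [Module ℂ V']
  {X : Set (Projectivization ℂ V)}

theorem isClosed_zariski_iff : @IsClosed _ (zariski V) X ↔ IsAlgebraic X := by
  rw [← @isOpen_compl_iff _ _ (zariski V)]
  change Xᶜᶜ ∈ {X | IsAlgebraic X} ↔ _
  rw [compl_compl]
  rfl

theorem isClosed_zeroLocus {S : Set (V → ℂ)}
    (hS : ∀ f ∈ S, f ∈ polyFun V ∧ ∃ d : ℕ, IsHomog f d) : @IsClosed _ (zariski V) (zeroLocus S) :=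
  isClosed_zariski_iff.2 ⟨S, hS, rfl⟩

theorem exists_rep_eq_smul {v : V} (hv : v ≠ 0) :
    ∃ a : ℂ, a ≠ 0 ∧ (Projectivization.mk ℂ v hv).rep = a • v := by
  obtain ⟨a, ha⟩ := Projectivization.exists_smul_eq_mk_rep ℂ v hv
  exact ⟨a, a.ne_zero, ha.symm⟩

theorem IsHomog.apply_rep_eq_zero_iff {f : V → ℂ} {d : ℕ} (hf : IsHomog f d) {v : V} (hv : v ≠ 0) :
    f (Projectivization.mk ℂ v hv).rep = 0 ↔ f v = 0 := by
  obtain ⟨a, ha, h⟩ := exists_rep_eq_smul hv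
  rw [h, hf]
  simp [ha]

theorem zero_mem_affineCone : (0 : V) ∈ affineCone X := fun h => absurd rfl h

theorem mem_affineCone_iff {v : V} (hv : v ≠ 0) :
    v ∈ affineCone X ↔ Projectivization.mk ℂ v hv ∈ X :=
  ⟨fun h => h hv, fun h _ => h⟩

theorem rep_mem_affineCone {P : Projectivization ℂ V} (hP : P ∈ X) : P.rep ∈ affineCone X := by
  intro h
  rwa [P.mk_rep]

theorem smul_mem_affineCone {v : V} (hv : v ∈ affineCone X) (c : ℂ) : c • v ∈ affineCone X := by
  intro h
  have hv0 : v ≠ 0 := by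
    rintro rfl
    simp at h
  have e : Projectivization.mk ℂ (c • v) h = Projectivization.mk ℂ v hv0 :=
    (Projectivization.mk_eq_mk_iff' ℂ _ _ _ _).2 ⟨c, rfl⟩
  rw [e]
  exact hv hv0

theorem apply_mem_affineCone_map_iff (e : V ≃ₗ[ℂ] V') {v : V} :
    e v ∈ affineCone (Projectivization.map (e : V →ₗ[ℂ] V') e.injective '' X) ↔
      v ∈ affineCone X := by
  by_cases hv : v = 0
  · subst hv
    simp [zero_mem_affineCone]
  have hev : e v ≠ 0 := by simpa using hv
  rw [mem_affineCone_iff hev, mem_affineCone_iff hv]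
  have h : Projectivization.mk ℂ (e v) hev =
      Projectivization.map (e : V →ₗ[ℂ] V') e.injective (Projectivization.mk ℂ v hv) := by
    rw [Projectivization.map_mk]
    rfl
  rw [h, (Projectivization.map_injective (e : V →ₗ[ℂ] V') e.injective).mem_set_image]

/-- A polynomial function vanishes on a line through the vertex if and only if all its homogeneous
components do. -/
theorem eval_coeff_eq_zero_iff {r : Polynomial (V → ℂ)} (hr : ∀ d, IsHomog (r.coeff d) d) (v : V) :
    (∀ d, r.coeff d v = 0) ↔ ∀ c : ℂ, r.eval 1 (c • v) = 0 := by
  have key : ∀ c : ℂ, r.eval 1 (c • v) = (r.map (Pi.evalRingHom (fun _ : V => ℂ) v)).eval c := by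
    intro c
    rw [Polynomial.eval_eq_sum_range, Polynomial.eval_map, Polynomial.eval₂_eq_sum_range]
    simp only [one_pow, mul_one, Finset.sum_apply, Pi.evalRingHom_apply]
    exact Finset.sum_congr rfl fun d _ => by rw [hr d, mul_comm]
  simp only [key]
  constructor
  · intro h c
    have : r.map (Pi.evalRingHom (fun _ : V => ℂ) v) = 0 := by
      ext d
      simpa using h d
    simp [this]
  · intro h d
    have : r.map (Pi.evalRingHom (fun _ : V => ℂ) v) = 0 := Polynomial.funext (by simpa using h)
    simpa using congrArg (Polynomial.coeff · d) this

/-- The lines on which a polynomial function vanishes form a closed subset of `ℙ V`. -/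
theorem isClosed_forall_smul_rep {f : V → ℂ} (hf : f ∈ polyFun V) :
    @IsClosed _ (zariski V) {P : Projectivization ℂ V | ∀ c : ℂ, f (c • P.rep) = 0} := by
  obtain ⟨r, hr, rfl⟩ := exists_homogeneousComponents hf
  convert isClosed_zeroLocus (V := V) (S := Set.range r.coeff) ?_ using 1
  · ext P
    simp [zeroLocus, ← eval_coeff_eq_zero_iff (fun d => (hr d).2)]
  · rintro _ ⟨d, rfl⟩
    exact ⟨(hr d).1, d, (hr d).2⟩

/-- The affine cone over the Zariski closure of `X` has the same polynomial equations as the affine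
cone over `X`. -/
theorem vanishingIdeal_affineCone_closure :
    vanishingIdeal (affineCone (@closure _ (zariski V) X)) = vanishingIdeal (affineCone X) := by
  let _ := zariski V
  refine le_antisymm (fun f hf α hα => hf α fun h => subset_closure (hα h)) fun f hf => ?_
  have hsub : closure X ⊆ {P : Projectivization ℂ V | ∀ c : ℂ, (f : V → ℂ) (c • P.rep) = 0} :=
    closure_minimal (fun P hP c => hf _ (smul_mem_affineCone (rep_mem_affineCone hP) c))
      (isClosed_forall_smul_rep f.2)
  intro α hα
  by_cases h0 : α = 0
  · subst h0
    exact hf 0 zero_mem_affineCone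
  obtain ⟨a, ha, h⟩ := exists_rep_eq_smul h0
  have := hsub (hα h0) a⁻¹
  rwa [h, inv_smul_smul₀ ha] at this

/-- An equation that fails somewhere on the cone fails somewhere on a line over a point of `X`. -/
theorem nonempty_inter_of_notMem_vanishingIdeal {f : polyFun V} (hX : X.Nonempty)
    (hf : f ∉ vanishingIdeal (affineCone X)) :
    (X ∩ {P : Projectivization ℂ V | ∀ c : ℂ, (f : V → ℂ) (c • P.rep) = 0}ᶜ).Nonempty := by
  by_contra hne
  rw [Set.inter_compl_nonempty_iff, not_not] at hne
  refine hf fun α hα => ?_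
  by_cases h0 : α = 0
  · subst h0
    obtain ⟨P, hP⟩ := hX
    simpa using hne hP 0
  obtain ⟨a, ha, h⟩ := exists_rep_eq_smul h0
  have := hne (hα h0) a⁻¹
  rwa [h, inv_smul_smul₀ ha] at this

/-- For `f` and `g` outside the ideal, irreducibility gives a line of the cone on which neither
vanishes identically; the product does not vanish on it either. -/
theorem vanishingIdeal_isPrime (hX : @IsIrreducible _ (zariski V) X) :
    (vanishingIdeal (affineCone X)).IsPrime := by
  let _ := zariski V
  obtain ⟨hne, hirr⟩ := hX
  refine ⟨fun htop => ?_, fun {f g} hfg => ?_⟩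
  · have : (1 : polyFun V) ∈ vanishingIdeal (affineCone X) := htop ▸ Submodule.mem_top
    simpa using this 0 zero_mem_affineCone
  · by_contra hnot
    rw [not_or] at hnot
    obtain ⟨P, hPX, hPf, hPg⟩ := hirr _ _ (isClosed_forall_smul_rep f.2).isOpen_compl
      (isClosed_forall_smul_rep g.2).isOpen_compl
      (nonempty_inter_of_notMem_vanishingIdeal hne hnot.1)
      (nonempty_inter_of_notMem_vanishingIdeal hne hnot.2)
    have key : ∀ h : polyFun V, ∃ r : Polynomial ℂ, ∀ c, (h : V → ℂ) (c • P.rep) = r.eval c := by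
      intro h
      obtain ⟨D, Q, hj⟩ := exists_isTwoJet h.2 0
      obtain ⟨r, hr, -⟩ := hj.exists_polynomial P.rep 0
      exact ⟨r, fun c => by simpa using hr c⟩
    obtain ⟨r, hr⟩ := key f
    obtain ⟨s, hs⟩ := key g
    have hrs : r * s = 0 := by
      refine Polynomial.funext fun c => ?_
      rw [Polynomial.eval_mul, ← hr, ← hs, Polynomial.eval_zero]
      exact hfg _ (smul_mem_affineCone (rep_mem_affineCone hPX) c)
    rcases mul_eq_zero.1 hrs with h | h
    · exact hPf fun c => by rw [hr, h, Polynomial.eval_zero]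
    · exact hPg fun c => by rw [hs, h, Polynomial.eval_zero]

theorem mem_tangentSpace_iff_of_isTwoJet {α v : V} :
    v ∈ tangentSpace X α ↔ ∀ f ∈ vanishingIdeal (affineCone X), ∀ D Q,
      IsTwoJet (f : V → ℂ) α D Q → D v = 0 := by
  refine ⟨fun h f hf D Q hj => (hj.hasDerivAt v).deriv.symm.trans (h f hf), fun h f hf => ?_⟩
  obtain ⟨D, Q, hj⟩ := exists_isTwoJet f.2 α
  exact (hj.hasDerivAt v).deriv.trans (h f hf D Q hj)

theorem mem_tangentSpace_of_apply_mem (e : V ≃ₗ[ℂ] V') {α v : V}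
    (h : e v ∈ tangentSpace (Projectivization.map (e : V →ₗ[ℂ] V') e.injective '' X) (e α)) :
    v ∈ tangentSpace X α := by
  intro f hf
  have := h ⟨fun y => (f : V → ℂ) (e.symm y),
    comp_linear_mem_polyFun (e.symm : V' →ₗ[ℂ] V) f.2⟩ fun y hy => hf _ ?_
  · simpa using this
  · rwa [← apply_mem_affineCone_map_iff e, e.apply_symm_apply]

/-- The conormal space of the cone at `p`: the differentials at `p` of its equations. -/
def conormalSpace (X : Set (Projectivization ℂ V)) (p : V) : Submodule ℂ (Dual ℂ V) where
  carrier := {D | ∃ f ∈ vanishingIdeal (affineCone X), ∃ Q, IsTwoJet (f : V → ℂ) p D Q}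
  zero_mem' := ⟨0, zero_mem _, 0, .const 0 p⟩
  add_mem' := by
    rintro _ _ ⟨f, hf, Q, h⟩ ⟨g, hg, Q', h'⟩
    exact ⟨f + g, add_mem hf hg, Q + Q', h.add h'⟩
  smul_mem' := by
    rintro c D ⟨f, hf, Q, h⟩
    have := (IsTwoJet.const c p).mul h
    rw [smul_zero, add_zero] at this
    exact ⟨algebraMap ℂ _ c * f, Ideal.mul_mem_left _ _ hf, _, this⟩

theorem dualCoannihilator_conormalSpace (p : V) :
    (conormalSpace X p).dualCoannihilator = tangentSpace X p := by
  ext v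
  rw [Submodule.mem_dualCoannihilator, mem_tangentSpace_iff_of_isTwoJet]
  exact ⟨fun h f hf D Q hj => h D ⟨f, hf, Q, hj⟩, fun h D ⟨f, hf, Q, hj⟩ => h f hf D Q hj⟩

theorem conormalSpace_eq_dualAnnihilator [FiniteDimensional ℂ V] (p : V) :
    conormalSpace X p = (tangentSpace X p).dualAnnihilator := by
  rw [← dualCoannihilator_conormalSpace, Subspace.dualCoannihilator_dualAnnihilator_eq]

/-- The cone over a closed `X` is cut out by its ideal. Since `X` is nonempty, its homogeneous
equations of degree `0` vanish at the vertex too. -/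
theorem mem_affineCone_iff_forall_vanishingIdeal (hcl : @IsClosed _ (zariski V) X)
    (hne : X.Nonempty) {α : V} :
    α ∈ affineCone X ↔ ∀ f ∈ vanishingIdeal (affineCone X), (f : V → ℂ) α = 0 := by
  refine ⟨fun hα f hf => hf α hα, fun h h0 => ?_⟩
  obtain ⟨S, hS, hXS⟩ := isClosed_zariski_iff.1 hcl
  rw [hXS]
  intro f hf
  obtain ⟨hp, d, hd⟩ := hS f hf
  rw [hd.apply_rep_eq_zero_iff h0]
  have hfX : ∀ P ∈ X, f P.rep = 0 := fun P hP => by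
    rw [hXS] at hP
    exact hP f hf
  refine h ⟨f, hp⟩ fun β hβ => ?_
  by_cases hβ0 : β = 0
  · obtain ⟨P, hP⟩ := hne
    simpa [hβ0, hfX P hP] using hd 0 P.rep
  · exact (hd.apply_rep_eq_zero_iff hβ0).1 (hfX _ (hβ hβ0))

theorem affineCone_injective :
    Function.Injective (affineCone : Set (Projectivization ℂ V) → Set V) := by
  intro X X' h
  ext P
  rw [← P.mk_rep, ← mem_affineCone_iff, h, mem_affineCone_iff]

end Cones

/-! ### The variety of a quadratic map -/

section Quadrics

variable {U W : Type*} [AddCommGroup U] [Module ℂ U] [AddCommGroup W] [Module ℂ W]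

/-- The quadratic map `(t, u) ↦ (t², tu, σ(u,u))` parametrizing the affine cone of `Z(σ)`. -/
def quadricMap (σ : U →ₗ[ℂ] U →ₗ[ℂ] W) (y : ℂ × U) : ℂ × U × W :=
  (y.1 ^ 2, y.1 • y.2, σ y.2 y.2)

theorem quadricMap_smul (σ : U →ₗ[ℂ] U →ₗ[ℂ] W) (c : ℂ) (y : ℂ × U) :
    quadricMap σ (c • y) = c ^ 2 • quadricMap σ y := by
  simp only [quadricMap, Prod.smul_fst, Prod.smul_snd, Prod.smul_mk, map_smul,
    LinearMap.smul_apply, smul_smul, smul_eq_mul]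
  ring_nf

theorem bilin_diag_mem_polyFun [FiniteDimensional ℂ U] (B : U →ₗ[ℂ] U →ₗ[ℂ] ℂ) :
    (fun u => B u u) ∈ polyFun U := by
  have h : (fun u => B u u) =
      ∑ i, ((finBasis ℂ U).coord i : U → ℂ) * (B (finBasis ℂ U i) : U → ℂ) := by
    funext u
    have e : B u = ∑ i, (finBasis ℂ U).repr u i • B (finBasis ℂ U i) := by
      conv_lhs => rw [← (finBasis ℂ U).sum_repr u, map_sum]
      simp
    simp [e]
  rw [h]
  exact sum_mem fun i _ => mul_mem (dual_mem_polyFun _) (dual_mem_polyFun _)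

theorem comp_quadricMap_mem_polyFun [FiniteDimensional ℂ U] (σ : U →ₗ[ℂ] U →ₗ[ℂ] W)
    {f : ℂ × U × W → ℂ} (hf : f ∈ polyFun (ℂ × U × W)) :
    (fun y => f (quadricMap σ y)) ∈ polyFun (ℂ × U) := by
  refine comp_mem_polyFun (fun φ => ?_) hf
  have ht := dual_mem_polyFun (LinearMap.fst ℂ ℂ U)
  have h1 := mul_mem ht (dual_mem_polyFun (φ (1, 0, 0) • LinearMap.fst ℂ ℂ U))
  have h2 := mul_mem ht (dual_mem_polyFun
    (φ ∘ₗ LinearMap.inr ℂ ℂ (U × W) ∘ₗ LinearMap.inl ℂ U W ∘ₗ LinearMap.snd ℂ ℂ U))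
  have h3 := comp_linear_mem_polyFun (LinearMap.snd ℂ ℂ U)
    (bilin_diag_mem_polyFun (σ.compr₂ (φ ∘ₗ LinearMap.inr ℂ ℂ (U × W) ∘ₗ LinearMap.inr ℂ U W)))
  refine (congrArg (· ∈ polyFun (ℂ × U)) (funext fun y => ?_)).mp (add_mem (add_mem h1 h2) h3)
  have e : quadricMap σ y = (y.1 * y.1) • (1, 0, 0) + y.1 • (0, y.2, 0) + (0, 0, σ y.2 y.2) := by
    ext <;> simp [quadricMap, sq]
  rw [e, map_add, map_add, map_smul, map_smul]
  simp [mul_assoc, mul_comm (φ (1, 0, 0))]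

/-- Over `ℂ` the image of `quadricMap` is itself a cone, since it absorbs squares. -/
theorem affineCone_image_quadricMap (σ : U →ₗ[ℂ] U →ₗ[ℂ] W) :
    affineCone {Q | ∃ (t : ℂ) (u : U) (h : (t ^ 2, t • u, σ u u) ≠ (0 : ℂ × U × W)),
      Q = Projectivization.mk ℂ (t ^ 2, t • u, σ u u) h} = Set.range (quadricMap σ) := by
  ext α
  constructor
  · intro hα
    by_cases h0 : α = 0
    · exact ⟨0, by simp [quadricMap, h0]⟩
    obtain ⟨t, u, h, hQ⟩ := hα h0
    obtain ⟨c, hc⟩ := (Projectivization.mk_eq_mk_iff' ℂ _ _ _ _).1 hQ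
    obtain ⟨μ, rfl⟩ := IsAlgClosed.exists_pow_nat_eq c (n := 2) (by norm_num)
    exact ⟨μ • (t, u), by rw [quadricMap_smul, ← hc]; rfl⟩
  · rintro ⟨y, rfl⟩ h
    exact ⟨y.1, y.2, h, rfl⟩

theorem mem_vanishingIdeal_quadricImage_iff {σ : U →ₗ[ℂ] U →ₗ[ℂ] W}
    {f : polyFun (ℂ × U × W)} :
    f ∈ vanishingIdeal (affineCone (quadricImage σ)) ↔
      ∀ y, (f : ℂ × U × W → ℂ) (quadricMap σ y) = 0 := by
  rw [quadricImage, vanishingIdeal_affineCone_closure, affineCone_image_quadricMap]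
  exact ⟨fun h y => h _ ⟨y, rfl⟩, fun h => by rintro _ ⟨y, rfl⟩; exact h y⟩

/-- At a point `quadricMap σ (t, u)` the vector `A_σ(x, ·)` is the velocity of a curve
`quadricMap σ (t + l s, u + l s')`; by polynomiality the vector field stays tangent on the whole
cone. -/
theorem quadricBilin_mem_tangentSpace {σ : U →ₗ[ℂ] U →ₗ[ℂ] W} (hσ : ∀ u v, σ u v = σ v u)
    (x : ℂ × U × W) {α : ℂ × U × W} (hα : α ∈ affineCone (quadricImage σ)) :
    quadricBilin σ x α ∈ tangentSpace (quadricImage σ) α := by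
  intro f hf
  obtain ⟨g, hg, hd⟩ := exists_lieDerivative (quadricBilin σ x) f.2
  rw [(hd α).deriv]
  suffices h : (⟨g, hg⟩ : polyFun _) ∈ vanishingIdeal (affineCone (quadricImage σ)) from h α hα
  rw [mem_vanishingIdeal_quadricImage_iff] at hf ⊢
  rintro ⟨t, u⟩
  obtain ⟨D, Q, hj⟩ := exists_isTwoJet f.2 (quadricMap σ (t, u))
  rw [show (⟨g, hg⟩ : polyFun (ℂ × U × W)).1 _ = g _ from rfl,
    (hd _).unique (hj.hasDerivAt _)]
  -- The curve `l ↦ quadricMap σ ((t, u) + l z)` has velocity `A_σ(x, ·)` at `l = 0`.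
  let z : ℂ × U := (x.1 * t / 2, (t / 2) • x.2.1)
  refine (hj.eq_zero_of_forall_ne_zero (w := quadricMap σ z) fun l _ => ?_).1
  rw [← hf ((t, u) + l • z)]
  refine congrArg (f : ℂ × U × W → ℂ) ?_
  refine Prod.ext ?_ (Prod.ext ?_ ?_)
  · simp [quadricMap, quadricBilin, z]
    ring
  · simp only [quadricMap, quadricBilin, z, LinearMap.mk₂_apply, Prod.fst_add, Prod.snd_add,
      Prod.smul_fst, Prod.smul_snd, smul_eq_mul]
    module
  · simp only [quadricMap, quadricBilin, z, LinearMap.mk₂_apply, Prod.fst_add, Prod.snd_add,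
      Prod.smul_fst, Prod.smul_snd, map_add, map_smul, LinearMap.add_apply, LinearMap.smul_apply,
      hσ u x.2.1]
    module

theorem quadricBilin_mem_prolongation {σ : U →ₗ[ℂ] U →ₗ[ℂ] W} (hσ : ∀ u v, σ u v = σ v u) :
    quadricBilin σ ∈ prolongation (autCone (quadricImage σ)) := by
  refine ⟨fun v w => ?_, fun w α hα => quadricBilin_mem_tangentSpace hσ w hα.1⟩
  simp only [quadricBilin, LinearMap.mk₂_apply, hσ v.2.1, mul_comm v.1, add_comm (v.1 • w.2.1)]

/-- The transport of `A_σ` along a linear isomorphism that carries `X` onto `Z(σ)`. -/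
theorem exists_mem_prolongation {V : Type*} [AddCommGroup V] [Module ℂ V]
    {X : Set (Projectivization ℂ V)} {σ : U →ₗ[ℂ] U →ₗ[ℂ] W}
    (hσ : ∀ u v, σ u v = σ v u) (e : V ≃ₗ[ℂ] ℂ × U × W)
    (hX : Projectivization.map (e : V →ₗ[ℂ] (ℂ × U × W)) e.injective '' X = quadricImage σ) :
    ∃ A ∈ prolongation (autCone X), ∀ v w : V, e (A v w) = quadricBilin σ (e v) (e w) := by
  let A : V →ₗ[ℂ] V →ₗ[ℂ] V := ((quadricBilin σ).compl₁₂ (e : V →ₗ[ℂ] ℂ × U × W)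
    (e : V →ₗ[ℂ] ℂ × U × W)).compr₂ (e.symm : (ℂ × U × W) →ₗ[ℂ] V)
  have hA : ∀ v w : V, e (A v w) = quadricBilin σ (e v) (e w) := fun v w => by simp [A]
  refine ⟨A, ⟨fun v w => e.injective ?_, fun w α hα => mem_tangentSpace_of_apply_mem e ?_⟩, hA⟩
  · rw [hA, hA, (quadricBilin_mem_prolongation hσ).1]
  · rw [hA, hX]
    exact quadricBilin_mem_tangentSpace hσ _ (by
      rw [← hX, apply_mem_affineCone_map_iff]
      exact hα.1)

/-- If `σ` were not surjective on `Sym² U`, a linear form would vanish on the cone over `Z(σ)`,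
against nondegeneracy. -/
theorem isSurjSym_of_map_image_eq {V : Type*} [AddCommGroup V] [Module ℂ V]
    {X : Set (Projectivization ℂ V)} {σ : U →ₗ[ℂ] U →ₗ[ℂ] W}
    (hσ : ∀ u v, σ u v = σ v u) (e : V ≃ₗ[ℂ] ℂ × U × W)
    (hX : Projectivization.map (e : V →ₗ[ℂ] (ℂ × U × W)) e.injective '' X = quadricImage σ)
    (hspan : Submodule.span ℂ (affineCone X) = ⊤) : IsSurjSym σ := by
  refine ⟨hσ, ?_⟩
  by_contra hne
  obtain ⟨φ, hφ, hle⟩ := Submodule.exists_le_ker_of_lt_top _ (lt_top_iff_ne_top.2 hne)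
  let ψ : Dual ℂ (ℂ × U × W) := φ ∘ₗ LinearMap.snd ℂ U W ∘ₗ LinearMap.snd ℂ ℂ (U × W)
  have hψ : (⟨ψ, dual_mem_polyFun ψ⟩ : polyFun (ℂ × U × W)) ∈
      vanishingIdeal (affineCone (quadricImage σ)) :=
    mem_vanishingIdeal_quadricImage_iff.2 fun y => hle (Submodule.subset_span ⟨y.2, y.2, rfl⟩)
  have hker : Submodule.span ℂ (affineCone X) ≤ LinearMap.ker (ψ ∘ₗ (e : V →ₗ[ℂ] ℂ × U × W)) :=
    Submodule.span_le.2 fun α hα => hψ (e α) (by rwa [← hX, apply_mem_affineCone_map_iff])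
  refine hφ (LinearMap.ext fun w => ?_)
  have := hker (hspan ▸ Submodule.mem_top : e.symm (0, 0, w) ∈ _)
  simpa [ψ] using this

end Quadrics

/-! ### Equations of a parametrized cone -/

section Parametrization

variable {V Y : Type*} [AddCommGroup V] [Module ℂ V]
  [AddCommGroup Y] [Module ℂ Y] [FiniteDimensional ℂ Y]

/-- A domain generated by linear forms `φ` is algebraic over a subalgebra `S` that contains `T` and
all products `T φ`, for some `T ≠ 0`. -/
theorem isAlgebraic_of_forall_dual {A : Type*} [CommRing A] [IsDomain A] [Algebra ℂ A]
    {q : polyFun V →ₐ[ℂ] A} (hq : Function.Surjective q) {S : Subalgebra ℂ A} {T : A} (hT : T ≠ 0)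
    (hTS : T ∈ S) (h : ∀ φ : Dual ℂ V, T * q ⟨φ, dual_mem_polyFun φ⟩ ∈ S) :
    Algebra.IsAlgebraic S A := by
  refine ⟨fun a => ?_⟩
  obtain ⟨⟨g, hg⟩, rfl⟩ := hq a
  change q ⟨g, hg⟩ ∈ Subalgebra.algebraicClosure S A
  induction hg using polyFun_induction with
  | dual φ =>
    refine ⟨.C ⟨T, hTS⟩ * .X - .C ⟨_, h φ⟩, fun h => hT ?_, ?_⟩
    · have := congrArg (Polynomial.coeff · 1) h
      simp only [Polynomial.coeff_sub, Polynomial.coeff_C_mul, Polynomial.coeff_X_one, mul_one,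
        Polynomial.coeff_C_succ, sub_zero, Polynomial.coeff_zero] at this
      exact congrArg Subtype.val this
    · simp only [map_sub, map_mul, Polynomial.aeval_C, Polynomial.aeval_X]
      exact sub_self _
  | const c =>
    have : q ⟨fun _ => c, (polyFun V).algebraMap_mem c⟩ = algebraMap S A (algebraMap ℂ S c) :=
      q.commutes c
    rw [this]
    exact isAlgebraic_algebraMap _
  | add f g hf hg ihf ihg =>
    rw [show (⟨f + g, add_mem hf hg⟩ : polyFun V) = ⟨f, hf⟩ + ⟨g, hg⟩ from rfl, map_add]
    exact add_mem ihf ihg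
  | mul f g hf hg ihf ihg =>
    rw [show (⟨f * g, mul_mem hf hg⟩ : polyFun V) = ⟨f, hf⟩ * ⟨g, hg⟩ from rfl, map_mul]
    exact mul_mem ihf ihg

/-- Let `C ⊆ V` have the domain `A` as its coordinate ring, let `v : Y → V` be a polynomial map and
`π : V → Y` linear, such that `v (π α)` is the multiple `τ (π α) • α` of `α` at the points `α ∈ C`
where `τ ∘ π` does not vanish, and suppose that there are such points. If `A` has
dimension at least `dim Y`, every equation of `C` vanishes on the image of `v`. Indeed `A` is
algebraic over the coordinates of `Y`, because `(τ ∘ π) φ = φ ∘ v ∘ π` in `A` for every linear form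
`φ`; by the assumption on the dimension those coordinates are algebraically independent, whereas
`f ∘ v` gives a relation among them for every equation `f`. -/
theorem vanishing_comp_of_finrank_le_ringKrullDim {A : Type*} [CommRing A] [IsDomain A]
    [Algebra ℂ A] [Algebra.FiniteType ℂ A] {C : Set V} (hC : ∀ (c : ℂ), ∀ α ∈ C, c • α ∈ C)
    (q : polyFun V →ₐ[ℂ] A) (hq : Function.Surjective q)
    (hker : ∀ f, q f = 0 ↔ f ∈ vanishingIdeal C)
    (π : V →ₗ[ℂ] Y) (v : Y → V) (hv : ∀ f ∈ polyFun V, (fun y => f (v y)) ∈ polyFun Y)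
    (τ : Dual ℂ Y) (hτ : ∃ α ∈ C, τ (π α) ≠ 0)
    (hvπ : ∀ α ∈ C, τ (π α) ≠ 0 → v (π α) = τ (π α) • α)
    (hdim : (finrank ℂ Y : WithBot ℕ∞) ≤ ringKrullDim A)
    {f : polyFun V} (hf : f ∈ vanishingIdeal C) (y : Y) : (f : V → ℂ) (v y) = 0 := by
  let B := finBasis ℂ Y
  let x : Fin (finrank ℂ Y) → polyFun V := fun i => ⟨_, dual_mem_polyFun (B.coord i ∘ₗ π)⟩
  let S := Algebra.adjoin ℂ (Set.range fun i => q (x i))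
  have aeval_eq : ∀ F : MvPolynomial (Fin (finrank ℂ Y)) ℂ,
      MvPolynomial.aeval (fun i => q (x i)) F = q (MvPolynomial.aeval x F) :=
    fun F => (MvPolynomial.comp_aeval_apply x q F).symm
  have aeval_apply : ∀ (F : MvPolynomial (Fin (finrank ℂ Y)) ℂ) (α : V),
      (MvPolynomial.aeval x F : V → ℂ) α = MvPolynomial.eval (fun i => B.coord i (π α)) F :=
    fun F α => eval_mvPolynomial_eq x F α
  have mem_S : ∀ g : polyFun V, (∃ h ∈ polyFun Y, ∀ α, (g : V → ℂ) α = h (π α)) → q g ∈ S := by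
    rintro g ⟨h, hh, hg⟩
    obtain ⟨F, hF⟩ := exists_mvPolynomial B hh
    have : g = MvPolynomial.aeval x F := Subtype.ext (funext fun α => by
      rw [aeval_apply, hg, hF])
    rw [this, ← aeval_eq]
    change _ ∈ Algebra.adjoin ℂ _
    rw [Algebra.adjoin_range_eq_range_aeval]
    exact ⟨F, rfl⟩
  let T : polyFun V := ⟨_, dual_mem_polyFun (τ ∘ₗ π)⟩
  have hT : q T ≠ 0 := by
    intro h
    obtain ⟨α, hα, h0⟩ := hτ
    exact h0 ((hker T).1 h α hα)
  have hTS : q T ∈ S := mem_S T ⟨τ, dual_mem_polyFun τ, fun _ => rfl⟩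
  -- An equation only has to be verified on `C` where `τ ≠ 0`, since `A` is a domain.
  have eq_zero : ∀ g : polyFun V, (∀ α ∈ C, τ (π α) ≠ 0 → (g : V → ℂ) α = 0) → q g = 0 := by
    intro g hg
    refine (mul_eq_zero.1 (?_ : q T * q g = 0)).resolve_left hT
    rw [← map_mul]
    refine (hker _).2 fun α hα => ?_
    by_cases h0 : τ (π α) = 0
    · simp [T, h0]
    · simp [hg α hα h0]
  have : Algebra.IsAlgebraic S A := by
    refine isAlgebraic_of_forall_dual hq hT hTS fun φ => ?_
    have hφv := hv φ (dual_mem_polyFun φ)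
    let G : polyFun V := ⟨_, comp_linear_mem_polyFun π hφv⟩
    have hG : q G ∈ S := mem_S G ⟨_, hφv, fun _ => rfl⟩
    rw [← map_mul, sub_eq_zero.1 (?_ : q (T * ⟨φ, dual_mem_polyFun φ⟩) - q G = 0)]
    · exact hG
    · rw [← map_sub]
      exact eq_zero _ fun α hα h0 => by simp [T, G, hvπ α hα h0]
  have hind : AlgebraicIndependent ℂ fun i => q (x i) :=
    algebraicIndependent_of_card_le_ringKrullDim _ (by simpa using hdim)
  obtain ⟨F, hF⟩ := exists_mvPolynomial B (hv f f.2)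
  have hF0 : MvPolynomial.aeval (fun i => q (x i)) F = 0 := by
    rw [aeval_eq]
    refine eq_zero _ fun α hα h0 => ?_
    rw [aeval_apply, ← hF, hvπ α hα h0]
    exact hf _ (hC _ α hα)
  rw [hF, hind.eq_zero_of_aeval_eq_zero F hF0, map_zero]

end Parametrization

/-! ### Consequences of a quadratic symmetry -/

section Symmetry

variable {V : Type*} [AddCommGroup V] [Module ℂ V] {X : Set (Projectivization ℂ V)}
  {P : Projectivization ℂ V} {T' N' : Submodule ℂ V}

theorem exists_equiv_prod (hd : Disjoint P.submodule T')
    (hc : IsCompl (P.submodule ⊔ T') N') :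
    ∃ e : V ≃ₗ[ℂ] ℂ × T' × N', ∀ t u w, e.symm (t, u, w) = t • P.rep + u + w := by
  let L : (ℂ × T' × N') →ₗ[ℂ] V := (LinearMap.toSpanSingleton ℂ V P.rep).coprod
    (T'.subtype.coprod N'.subtype)
  have hL : ∀ t u w, L (t, u, w) = t • P.rep + u + w := fun t u w => by simp [L, add_assoc]
  have hinj : Function.Injective L := by
    rw [injective_iff_map_eq_zero]
    rintro ⟨t, u, w⟩ h
    rw [hL] at h
    have ht : t • P.rep ∈ P.submodule := by
      rw [P.submodule_eq]
      exact Submodule.smul_mem _ _ (Submodule.mem_span_singleton_self _)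
    have hw : (w : V) = 0 := by
      refine Submodule.disjoint_def.1 hc.disjoint _ ?_ w.2
      rw [← neg_eq_of_add_eq_zero_right h]
      exact neg_mem (Submodule.add_mem_sup ht u.2)
    rw [hw, add_zero] at h
    have hu : (u : V) = 0 := by
      refine Submodule.disjoint_def.1 hd _ ?_ u.2
      rw [← neg_eq_of_add_eq_zero_right h]
      exact neg_mem ht
    rw [hu, add_zero, smul_eq_zero_iff_left P.rep_nonzero] at h
    ext <;> simp [h, hu, hw]
  have hsurj : Function.Surjective L := by
    intro x
    have hx : x ∈ P.submodule ⊔ T' ⊔ N' := hc.sup_eq_top ▸ Submodule.mem_top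
    obtain ⟨y, hy, w, hw, rfl⟩ := Submodule.mem_sup.1 hx
    obtain ⟨p, hp, u, hu, rfl⟩ := Submodule.mem_sup.1 hy
    rw [P.submodule_eq] at hp
    obtain ⟨t, rfl⟩ := Submodule.mem_span_singleton.1 hp
    exact ⟨(t, ⟨u, hu⟩, ⟨w, hw⟩), hL _ _ _⟩
  exact ⟨(LinearEquiv.ofBijective L ⟨hinj, hsurj⟩).symm, hL⟩

/-- On the orbit `p + l u + l² w` of a point of the cone an equation vanishes identically, and the
coefficient of `l²` is the relation `D w + Q u u = 0`. -/
theorem IsTwoJet.add_eq_zero_of_symmetry {E : ℂˣ →* (V ≃ₗ[ℂ] V)}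
    (hE : ∀ (l : ℂˣ), ∀ t ∈ P.submodule, ∀ u ∈ T', ∀ w ∈ N',
      E l (t + u + w) = t + (l : ℂ) • u + ((l : ℂ) ^ 2) • w)
    (hX : ∀ l : ℂˣ, Projectivization.map (E l : V →ₗ[ℂ] V) (E l).injective '' X = X)
    {f : polyFun V} (hf : f ∈ vanishingIdeal (affineCone X)) {D : Dual ℂ V}
    {Q : V →ₗ[ℂ] V →ₗ[ℂ] ℂ} (hj : IsTwoJet (f : V → ℂ) P.rep D Q) {u w : V} (hu : u ∈ T')
    (hw : w ∈ N') (h : P.rep + u + w ∈ affineCone X) : D w + Q u u = 0 := by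
  refine (hj.eq_zero_of_forall_ne_zero fun l hl => hf _ ?_).2
  have hp : P.rep ∈ P.submodule := by
    rw [P.submodule_eq]
    exact Submodule.mem_span_singleton_self _
  have := hE (Units.mk0 l hl) _ hp u hu w hw
  rw [Units.val_mk0] at this
  rw [← this, ← hX (Units.mk0 l hl), apply_mem_affineCone_map_iff]
  exact h

/-- A quadratic symmetry at `P` exhibits the chart of `X` around `P` as part of the graph of a
quadratic map: by the conormal description of the tangent space every coordinate of `N'` is the
linear part `D` of some equation of the cone, and then `D w = - Q u u`. -/
theorem exists_graph [FiniteDimensional ℂ V] {E : ℂˣ →* (V ≃ₗ[ℂ] V)}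
    (hT : P.submodule ⊔ T' = tangentSpace X P.rep)
    (hE : ∀ (l : ℂˣ), ∀ t ∈ P.submodule, ∀ u ∈ T', ∀ w ∈ N',
      E l (t + u + w) = t + (l : ℂ) • u + ((l : ℂ) ^ 2) • w)
    (hX : ∀ l : ℂˣ, Projectivization.map (E l : V →ₗ[ℂ] V) (E l).injective '' X = X)
    (e : V ≃ₗ[ℂ] ℂ × T' × N') (he : ∀ t u w, e.symm (t, u, w) = t • P.rep + u + w) :
    ∃ σ : T' →ₗ[ℂ] T' →ₗ[ℂ] N', (∀ u v, σ u v = σ v u) ∧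
      ∀ (t : ℂ) (u : T') (w : N'), t ≠ 0 → e.symm (t, u, w) ∈ affineCone X → t • w = σ u u := by
  let b := finBasis ℂ N'
  let φ : Fin (finrank ℂ N') → Dual ℂ V := fun j => b.coord j ∘ₗ
    LinearMap.snd ℂ T' N' ∘ₗ LinearMap.snd ℂ ℂ (T' × N') ∘ₗ (e : V →ₗ[ℂ] ℂ × T' × N')
  have hφ : ∀ j, φ j ∈ conormalSpace X P.rep := by
    intro j
    rw [conormalSpace_eq_dualAnnihilator, ← hT, Submodule.mem_dualAnnihilator]
    intro v hv
    obtain ⟨p, hp, u, hu, rfl⟩ := Submodule.mem_sup.1 hv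
    rw [P.submodule_eq] at hp
    obtain ⟨t, rfl⟩ := Submodule.mem_span_singleton.1 hp
    have : t • P.rep + u = e.symm (t, ⟨u, hu⟩, 0) := by simp [he]
    simp [φ, this]
  choose f hf Q hj using hφ
  refine ⟨∑ j, ((Q j).domRestrict₁₂ T' T').compr₂ (-(LinearMap.toSpanSingleton ℂ N' (b j))),
    fun u v => ?_, fun t u w ht h => ?_⟩
  · simp [LinearMap.domRestrict₁₂_apply, (hj _).symm u v]
  have h1 : P.rep + ((t⁻¹ • u : T') : V) + ((t⁻¹ • w : N') : V) ∈ affineCone X := by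
    convert smul_mem_affineCone h t⁻¹ using 1
    rw [he]
    simp [smul_smul, ht]
  have key : ∀ j, b.repr (t • w) j = - Q j u u := by
    intro j
    have h2 := (hj j).add_eq_zero_of_symmetry hE hX (hf j) (t⁻¹ • u : T').2 (t⁻¹ • w : N').2 h1
    have h3 : ((t⁻¹ • w : N') : V) = e.symm (0, 0, t⁻¹ • w) := by simp [he]
    have h4 : φ j ((t⁻¹ • w : N') : V) = t⁻¹ * b.repr w j := by
      rw [h3]
      simp [φ]
    rw [h4, Submodule.coe_smul, map_smul, map_smul, LinearMap.smul_apply] at h2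
    simp only [smul_eq_mul] at h2
    rw [map_smul, Finsupp.smul_apply, smul_eq_mul]
    field_simp at h2
    linear_combination h2
  conv_lhs => rw [← b.sum_repr (t • w)]
  simp only [key]
  simp [LinearMap.domRestrict₁₂_apply]

end Symmetry

/-! ### Recognition of the variety of a quadratic map -/

section Classification

/-- The quotient by a prime ideal, packed into existential quantifiers so that it can be used as an
abstract algebra whose ring structure is not unfolded. -/
theorem exists_quotient_by_prime.{u, v} {k : Type u} {R : Type v} [Field k] [CommRing R]
    [Algebra k R] [Algebra.FiniteType k R] (I : Ideal R) [I.IsPrime] :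
    ∃ (A : Type v) (_ : CommRing A) (_ : IsDomain A) (_ : Algebra k A)
      (_ : Algebra.FiniteType k A) (q : R →ₐ[k] A), Function.Surjective q ∧
        (∀ f, q f = 0 ↔ f ∈ I) ∧ ringKrullDim A = ringKrullDim (R ⧸ I) :=
  ⟨R ⧸ I, inferInstance, inferInstance, inferInstance,
    .of_surjective (Ideal.Quotient.mkₐ k I) (Ideal.Quotient.mkₐ_surjective k I),
    Ideal.Quotient.mkₐ k I, Ideal.Quotient.mkₐ_surjective k I,
    fun _ => Ideal.Quotient.eq_zero_iff_mem, rfl⟩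

variable {V U W : Type*} [AddCommGroup V] [Module ℂ V] [FiniteDimensional ℂ V]
  [AddCommGroup U] [Module ℂ U] [FiniteDimensional ℂ U] [AddCommGroup W] [Module ℂ W]
  {X : Set (Projectivization ℂ V)} {σ : U →ₗ[ℂ] U →ₗ[ℂ] W}

/-- An irreducible closed `X` of the right dimension whose chart `t ≠ 0` lies in the graph of `σ` is
`Z(σ)`. -/
theorem map_image_eq_quadricImage (hcl : @IsClosed _ (zariski V) X)
    (hirr : @IsIrreducible _ (zariski V) X) (e : V ≃ₗ[ℂ] ℂ × U × W)
    (hne : ∃ α ∈ affineCone X, (e α).1 ≠ 0)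
    (hgraph : ∀ α ∈ affineCone X, (e α).1 ≠ 0 → (e α).1 • (e α).2.2 = σ (e α).2.1 (e α).2.1)
    (hdim : (finrank ℂ (ℂ × U) : WithBot ℕ∞) ≤
      ringKrullDim (polyFun V ⧸ vanishingIdeal (affineCone X))) :
    Projectivization.map (e : V →ₗ[ℂ] (ℂ × U × W)) e.injective '' X = quadricImage σ := by
  have hI : (vanishingIdeal (affineCone X)).IsPrime := vanishingIdeal_isPrime hirr
  obtain ⟨A, _, _, _, _, q, hq, hker, hA⟩ :=
    exists_quotient_by_prime (k := ℂ) (vanishingIdeal (affineCone X))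
  rw [← hA] at hdim
  let π : V →ₗ[ℂ] ℂ × U :=
    ((LinearMap.fst ℂ ℂ (U × W)).prod (LinearMap.fst ℂ U W ∘ₗ LinearMap.snd ℂ ℂ (U × W))) ∘ₗ
      (e : V →ₗ[ℂ] ℂ × U × W)
  have hπ : ∀ α ∈ affineCone X, (e α).1 ≠ 0 → quadricMap σ (π α) = (e α).1 • e α := by
    intro α hα h0
    change ((e α).1 ^ 2, (e α).1 • (e α).2.1, σ (e α).2.1 (e α).2.1) = _
    rw [← hgraph α hα h0, sq]
    rfl
  have hv : ∀ f ∈ polyFun V, (fun y => f (e.symm (quadricMap σ y))) ∈ polyFun (ℂ × U) :=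
    fun f hf => comp_quadricMap_mem_polyFun σ
      (comp_linear_mem_polyFun (e.symm : (ℂ × U × W) →ₗ[ℂ] V) hf)
  have hmem : ∀ f : polyFun V, f ∈ vanishingIdeal (affineCone X) ↔
      ∀ y, (f : V → ℂ) (e.symm (quadricMap σ y)) = 0 := by
    refine fun f => ⟨fun hf y => ?_, fun hf => ?_⟩
    · refine vanishing_comp_of_finrank_le_ringKrullDim (fun c α hα => smul_mem_affineCone hα c)
        q hq hker π (fun y => e.symm (quadricMap σ y)) hv (LinearMap.fst ℂ ℂ U) hne
        (fun α hα h0 => ?_) hdim hf y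
      rw [hπ α hα h0, map_smul, e.symm_apply_apply]
      rfl
    · let T : polyFun V := ⟨_, dual_mem_polyFun (LinearMap.fst ℂ ℂ (U × W) ∘ₗ
        (e : V →ₗ[ℂ] ℂ × U × W))⟩
      have hT : T ∉ vanishingIdeal (affineCone X) := by
        obtain ⟨α, hα, h0⟩ := hne
        exact fun h => h0 (h α hα)
      refine (hI.mem_or_mem (x := T) fun α hα => ?_).resolve_left hT
      by_cases h0 : (e α).1 = 0
      · simp [T, h0]
      · -- Every point of the cone with `t ≠ 0` is proportional to one in the image of `quadricMap`.
        obtain ⟨c, hc⟩ := IsAlgClosed.exists_pow_nat_eq (e α).1⁻¹ (n := 2) (by norm_num)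
        have := hf (c • π α)
        rw [quadricMap_smul, hπ α hα h0, hc, inv_smul_smul₀ h0, e.symm_apply_apply] at this
        simp [this]
  have hZcl : @IsClosed _ (zariski (ℂ × U × W)) (quadricImage σ) := by
    let _ := zariski (ℂ × U × W)
    exact isClosed_closure
  have hZne : (quadricImage σ).Nonempty := by
    let _ := zariski (ℂ × U × W)
    exact Set.Nonempty.mono subset_closure ⟨_, 1, 0, by simp, rfl⟩
  refine affineCone_injective (Set.ext fun y => ?_)
  obtain ⟨α, rfl⟩ := e.surjective y
  rw [apply_mem_affineCone_map_iff, mem_affineCone_iff_forall_vanishingIdeal hcl hirr.1,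
    mem_affineCone_iff_forall_vanishingIdeal hZcl hZne]
  constructor
  · intro h g hg
    have := h ⟨_, comp_linear_mem_polyFun (e : V →ₗ[ℂ] ℂ × U × W) g.2⟩ ((hmem _).2 fun y => ?_)
    · exact this
    · simpa using mem_vanishingIdeal_quadricImage_iff.1 hg y
  · intro h f hf
    have := h ⟨_, comp_linear_mem_polyFun (e.symm : (ℂ × U × W) →ₗ[ℂ] V) f.2⟩
      (mem_vanishingIdeal_quadricImage_iff.2 fun y => (hmem f).1 hf y)
    simpa using this

end Classification

/-! ### Quadratically symmetric varieties -/

section QuadraticallySymmetric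

variable {V : Type*} [AddCommGroup V] [Module ℂ V] [FiniteDimensional ℂ V]
  {X : Set (Projectivization ℂ V)}

theorem IsQuadraticallySymmetric.exists_equiv (hX : IsQuadraticallySymmetric X) :
    ∃ (U W : Submodule ℂ V) (σ : U →ₗ[ℂ] U →ₗ[ℂ] W) (e : V ≃ₗ[ℂ] (ℂ × U × W)),
      IsSurjSym σ ∧
      Projectivization.map (e : V →ₗ[ℂ] (ℂ × U × W)) e.injective '' X = quadricImage σ := by
  obtain ⟨O, -, ⟨P, hP⟩, hsm, hsymm⟩ := hX.exists_symmetry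
  obtain ⟨E, ⟨T', N', hd, hT, hc, hE⟩, hEX⟩ := hsymm P hP
  obtain ⟨e, he⟩ := exists_equiv_prod hd hc
  obtain ⟨σ, hσ, hgraph⟩ := exists_graph hT hE hEX e he
  have hrank : finrank ℂ (ℂ × T') = finrank ℂ (tangentSpace X P.rep) := by
    have := Submodule.finrank_sup_add_finrank_inf_eq P.submodule T'
    rw [hd.eq_bot, finrank_bot, add_zero, P.finrank_submodule, hT] at this
    rw [this, finrank_prod, finrank_self]
  have heP : e P.rep = (1, 0, 0) := by
    rw [← e.apply_symm_apply (1, 0, 0), he]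
    simp
  have hmap := map_image_eq_quadricImage (σ := σ) hX.isClosed hX.irreducible e
    ⟨P.rep, rep_mem_affineCone hP.1, by simp [heP]⟩
    (fun α hα h0 => hgraph _ _ _ h0 (by simpa using hα))
    (by rw [hrank, (hsm hP).2.2])
  exact ⟨T', N', σ, e, isSurjSym_of_map_image_eq hσ e hmap hX.nondegenerate, hmap⟩

end QuadraticallySymmetric

end QuadSymm

theorem proposition6 :
    (∀ (V : Type*) [AddCommGroup V] [Module ℂ V] [FiniteDimensional ℂ V]
      (X : Set (Projectivization ℂ V)), QuadSymm.IsQuadraticallySymmetric X →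
      QuadSymm.prolongation (QuadSymm.autCone X) ≠ ⊥ ∧
      ∃ (U W : Submodule ℂ V) (σ : U →ₗ[ℂ] U →ₗ[ℂ] W) (e : V ≃ₗ[ℂ] (ℂ × U × W)),
        QuadSymm.IsSurjSym σ ∧
        Projectivization.map (e : V →ₗ[ℂ] (ℂ × U × W)) e.injective '' X =
          QuadSymm.quadricImage σ ∧
        ∃ A ∈ QuadSymm.prolongation (QuadSymm.autCone X),
          ∀ v w : V, e (A v w) = QuadSymm.quadricBilin σ (e v) (e w)) ∧
    (∀ (U W : Type*) [AddCommGroup U] [Module ℂ U] [FiniteDimensional ℂ U]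
      [AddCommGroup W] [Module ℂ W] [FiniteDimensional ℂ W]
      (σ : U →ₗ[ℂ] U →ₗ[ℂ] W), QuadSymm.IsSurjSym σ →
      QuadSymm.quadricBilin σ ∈
        QuadSymm.prolongation (QuadSymm.autCone (QuadSymm.quadricImage σ))) := by
  refine ⟨fun V _ _ _ X hX => ?_, fun U W _ _ _ _ _ _ σ hσ =>
    QuadSymm.quadricBilin_mem_prolongation hσ.symm⟩
  obtain ⟨U, W, σ, e, hσ, hmap⟩ := hX.exists_equiv
  obtain ⟨A, hA, hAe⟩ := QuadSymm.exists_mem_prolongation hσ.symm e hmap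
  refine ⟨fun hbot => ?_, U, W, σ, e, hσ, hmap, A, hA, hAe⟩
  -- `A_σ` takes the value `(1, 0, 0)` at the pair `(1, 0, 0), (1, 0, 0)`.
  have hA0 : A = 0 := by simpa [hbot] using hA
  have := hAe (e.symm (1, 0, 0)) (e.symm (1, 0, 0))
  simp [hA0, QuadSymm.quadricBilin, Prod.ext_iff] at this
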